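/- Let $(\mathbb T,\trianglelefteq)$ be a \emph{directed tree}, that is, a (non-empty) poset such that (T1) for every $v\in\mathbb T$ the set $\{u : v\trianglelefteq u\}$ is totally ordered and order-isomorphic to the half-line $[0,+\infty)$; (T2) any two points of $\mathbb T$ have a smallest common upper bound; (T3) there is a countable subset $\Sigma\subset\mathbb T$ such that for all distinct $u\trianglelefteq v$ in $\mathbb T$ there is $z\in\Sigma$ with $u\trianglelefteq z\trianglelefteq v$. Write $u\triangleleft v$ if $u\trianglelefteq v$ and $u\ne v$, and in this case let $[u,v]=\{w: u\trianglelefteq w\trianglelefteq v\}$, $[u,v[\,=[u,v]\setminus\{v\}$ and $]u,v[\,=[u,v]\setminus\{u,v\}$. Assume that $\mathbb T$ has no leaves (i.e. no $\trianglelefteq$-minimal points) and that $(\mathbb T,\trianglelefteq)$ is not order-isomorphic to $(\mathbb R,\le)$. Let $G$ be a virtually solvable group, and let $\Phi\colon G\to\operatorname{Aut}(\mathbb T,\trianglelefteq)$ be an action which is \emph{d-minimal}: for all $v_1\triangleleft v_2$ and $w_-\triangleleft w$ in $\mathbb T$ there exist $g\in G$ and $w'\in[w_-,w[$ such that $\Phi(g)([w',w])\subset\,]v_1,v_2[$.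 Then there is an action $j\colon G\to\operatorname{Homeo}_0(\mathbb R)$ of $G$ on the line by orientation-preserving homeomorphisms such that (1) $j$ is minimal, i.e. every $j(G)$-orbit is dense in $\mathbb R$; (2) $\operatorname{Fit}(G)\subset\ker j$, where $\operatorname{Fit}(G)$ is the subgroup generated by all nilpotent normal subgroups of $G$; (3) $\Phi$ is horograded by $j$: there is a surjective map $\pi\colon\mathbb T\to\mathbb R$ with $\pi(\Phi(g)(v))=j(g)(\pi(v))$ for all $g\in G$, $v\in\mathbb T$, which is increasing ($u\triangleleft v$ implies $\pi(u)<\pi(v)$) and which, for all $u\triangleleft v$, restricts to an order-preserving bijection from $[u,v]$ onto the interval $[\pi(u),\pi(v)]$. -/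

import Mathlib

/-- A group is virtually solvable if it has a solvable subgroup of finite index. -/
def IsVirtuallySolvable (G : Type*) [Group G] : Prop :=
  ∃ H : Subgroup G, H.FiniteIndex ∧ Group.IsSolvable H

/-- The Fitting subgroup: the subgroup generated by all nilpotent normal subgroups. -/
def fittingSubgroup (G : Type*) [Group G] : Subgroup G :=
  sSup {N : Subgroup G | N.Normal ∧ Group.IsNilpotent N}

/-- The group of orientation-preserving homeomorphisms of the real line. -/
def HomeoPlus : Subgroup (ℝ ≃ₜ ℝ) where
  carrier := {f | StrictMono f}
  mul_mem' := by
    intro f g hf hg x y hxy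
    have hf' : StrictMono f := hf
    have hg' : StrictMono g := hg
    exact hf' (hg' hxy)
  one_mem' := strictMono_id
  inv_mem' := by
    intro f hf x y hxy
    have hf' : StrictMono f := hf
    have key : f (f.symm x) < f (f.symm y) := by simpa using hxy
    exact hf'.lt_iff_lt.mp key

/-- An action on the line is minimal if every orbit is dense. -/
def IsMinimalLineAction {G : Type*} [Group G] (j : G →* HomeoPlus) : Prop :=
  ∀ x : ℝ, Dense (Set.range fun g : G => (j g : ℝ ≃ₜ ℝ) x)

/-- Directed trees: the poset `T` in which `u ≤ v` means that `v` lies on the ray going from `u` to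
the focus. -/
structure IsDirectedTree (T : Type*) [PartialOrder T] : Prop where
  /-- Every `{u | v ≤ u}` is (totally ordered and) order-isomorphic to `[0, +∞)`. -/
  ray : ∀ v : T, Nonempty (Set.Ici v ≃o Set.Ici (0 : ℝ))
  /-- Any two points have a smallest common upper bound. -/
  directed : ∀ u v : T, ∃ w : T, IsLUB {u, v} w
  /-- Some countable subset meets every nondegenerate arc `[u, v]`, `u < v`. -/
  countable : ∃ S : Set T, S.Countable ∧ ∀ u v : T, u < v → ∃ z ∈ S, u ≤ z ∧ z ≤ v

/-- d-minimality (directional minimality) of an action by automorphisms of a directed tree. For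
comparable points, arcs are order intervals. -/
def IsDMinimal {G T : Type*} [Group G] [PartialOrder T] (Φ : G →* (T ≃o T)) : Prop :=
  ∀ v₁ v₂ w₀ w : T, v₁ < v₂ → w₀ < w →
    ∃ g : G, ∃ w' ∈ Set.Ico w₀ w, Φ g '' Set.Icc w' w ⊆ Set.Ioo v₁ v₂

/-- (Positive) horogradings of a directed tree: increasing maps to the line which restrict to an
order-preserving bijection `[u, v] → [π u, π v]` whenever `u < v`. -/
structure IsHorograding {T : Type*} [PartialOrder T] (π : T → ℝ) : Prop where
  strictMono : StrictMono π
  bijOn : ∀ u v : T, u < v → Set.BijOn π (Set.Icc u v) (Set.Icc (π u) (π v))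

/-- The action `Φ` on a directed tree is horograded by the action `j` on the line. -/
def IsHorogradedBy {G T : Type*} [Group G] [PartialOrder T]
    (Φ : G →* (T ≃o T)) (j : G →* HomeoPlus) : Prop :=
  ∃ π : T → ℝ, IsHorograding π ∧ Function.Surjective π ∧
    ∀ (g : G) (v : T), π (Φ g v) = (j g : ℝ ≃ₜ ℝ) (π v)

/-! Call a subgroup horizontal if it moves no point to a different comparable one. A normal subgroup
`M` induces a `G`-invariant preorder `OrbitLE` on its orbits. The heart is the ping-pong alternative
`IsHorizontal.of_satisfiesMalcevMod`: if `M` has two incomparable orbits, any non-horizontal normal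
subgroup contains two elements violating every Malcev law modulo `M`.

Apply this along the derived series of a solvable normal subgroup of finite index. Horizontal
subgroups have infinite index, so the first horizontal term `M` has a predecessor, which is not
horizontal but abelian modulo `M`. Hence the orbits of `M` are totally ordered. They form a line,
`π` is the quotient map and `j` the induced action, minimal by d-minimality.

With `M` trivial, the same alternative shows that nilpotent normal subgroups are horizontal, because
a tree that is not a line has incomparable points. Their elements fix a ray pointwise, so they act
trivially near `+∞`, and minimality of `j` then forces them into the kernel
(`le_ker_of_isNilpotent`). -/

/-! ### A positive semigroup law in nilpotent groups -/

/-- The pairs of words `(u₀, v₀) = (a, b)`, `(uₙ₊₁, vₙ₊₁) = (uₙ vₙ, vₙ uₙ)`. -/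
def malcevWords {G : Type*} [Group G] (a b : G) : ℕ → G × G
  | 0 => (a, b)
  | n + 1 => ((malcevWords a b n).1 * (malcevWords a b n).2,
      (malcevWords a b n).2 * (malcevWords a b n).1)

/-- `K` satisfies some Malcev law modulo `M`, for each pair of elements. -/
def SatisfiesMalcevMod {G : Type*} [Group G] (K M : Subgroup G) : Prop :=
  ∀ a ∈ K, ∀ b ∈ K, ∃ n, ∃ z ∈ M, (malcevWords a b n).1 = (malcevWords a b n).2 * z

open scoped commutatorElement in
-- If `u = v * z`, the next pair is `v * z * v` and `v * v * z`, whose quotient is the commutator of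
-- `z⁻¹` and `v⁻¹`, one step deeper in the lower central series.
theorem malcevWords_lowerCentralSeries {G : Type*} [Group G] (N : Subgroup G) {a b : G}
    (ha : a ∈ N) (hb : b ∈ N) (n : ℕ) :
    (malcevWords a b n).2 ∈ N ∧ ∃ z ∈ N.lowerCentralSeries n,
      (malcevWords a b n).1 = (malcevWords a b n).2 * z := by
  induction n with
  | zero => exact ⟨hb, b⁻¹ * a, mul_mem (inv_mem hb) ha, by simp [malcevWords]⟩
  | succ n ih =>
    obtain ⟨hv, z, hz, h⟩ := ih
    have hzN := N.lowerCentralSeries_le_self n hz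
    refine ⟨?_, ⁅z⁻¹, (malcevWords a b n).2⁻¹⁆, ?_, ?_⟩
    · simp only [malcevWords]
      rw [h]
      exact mul_mem hv (mul_mem hv hzN)
    · rw [Subgroup.lowerCentralSeries_succ]
      exact Subgroup.commutator_mem_commutator (inv_mem hz) (inv_mem hv)
    · simp only [malcevWords]
      rw [h, commutatorElement_def]
      group

theorem SatisfiesMalcevMod.of_isNilpotent {G : Type*} [Group G] (N : Subgroup G)
    (hN : Group.IsNilpotent N) : SatisfiesMalcevMod N ⊥ := by
  intro a ha b hb
  obtain ⟨n, hn⟩ := (Subgroup.isNilpotent_iff_lowerCentralSeries N).1 hN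
  exact ⟨n, hn ▸ (malcevWords_lowerCentralSeries N ha hb n).2⟩

open scoped commutatorElement in
theorem SatisfiesMalcevMod.commutator {G : Type*} [Group G] (K : Subgroup G) :
    SatisfiesMalcevMod K ⁅K, K⁆ := by
  intro a ha b hb
  refine ⟨1, ⁅a⁻¹, b⁻¹⁆,
    Subgroup.commutator_mem_commutator (inv_mem ha) (inv_mem hb), ?_⟩
  simp only [malcevWords]
  rw [commutatorElement_def]
  group

/-! ### Derived series of a virtually solvable group -/

/-- The derived series of a subgroup, inside the ambient group. -/
def derivedChain {G : Type*} [Group G] (H : Subgroup G) : ℕ → Subgroup G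
  | 0 => H
  | n + 1 => ⁅derivedChain H n, derivedChain H n⁆

theorem derivedChain_normal {G : Type*} [Group G] (H : Subgroup G) [hH : H.Normal] (n : ℕ) :
    (derivedChain H n).Normal := by
  induction n with
  | zero => exact hH
  | succ n ih => exact Subgroup.commutator_normal _ _

theorem derivedChain_eq_map {G : Type*} [Group G] (H : Subgroup G) (n : ℕ) :
    derivedChain H n = (derivedSeries H n).map H.subtype := by
  induction n with
  | zero => rw [derivedChain, derivedSeries_zero, ← MonoidHom.range_eq_map, H.range_subtype]
  | succ n ih => rw [derivedChain, derivedSeries_succ, Subgroup.map_commutator, ih]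

/-- A virtually solvable group has a normal subgroup of finite index with trivial
`derivedChain`. -/
theorem IsVirtuallySolvable.exists_normal {G : Type*} [Group G] (hG : IsVirtuallySolvable G) :
    ∃ H : Subgroup G, H.Normal ∧ H.FiniteIndex ∧ ∃ n, derivedChain H n = ⊥ := by
  obtain ⟨H, hfin, hsol⟩ := hG
  refine ⟨H.normalCore, inferInstance, inferInstance, ?_⟩
  have hs : Group.IsSolvable H.normalCore :=
    Group.isSolvable_of_isSolvable_injective (Subgroup.inclusion_injective H.normalCore_le)
  obtain ⟨n, hn⟩ := (Group.isSolvable_def _).1 hs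
  exact ⟨n, by rw [derivedChain_eq_map, hn, Subgroup.map_bot]⟩

/-! ### Order structure of directed trees -/

namespace IsDirectedTree

variable {T : Type*} [PartialOrder T]

theorem le_total_of_le (hT : IsDirectedTree T) {a x y : T} (hx : a ≤ x) (hy : a ≤ y) :
    x ≤ y ∨ y ≤ x := by
  obtain ⟨e⟩ := hT.ray a
  rcases le_total (e ⟨x, hx⟩) (e ⟨y, hy⟩) with h | h
  · exact Or.inl (e.le_iff_le.1 h)
  · exact Or.inr (e.le_iff_le.1 h)

theorem exists_isGLB (hT : IsDirectedTree T) {a b : T} {B : Set T} (hB : ∀ z ∈ B, a ≤ z)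
    (hb : b ∈ B) : ∃ c, a ≤ c ∧ (∀ z ∈ B, c ≤ z) ∧ ∀ w, c < w → ∃ z ∈ B, z < w := by
  obtain ⟨e⟩ := hT.ray a
  set S : Set ℝ := {r | ∃ z, ∃ h : z ∈ B, r = e ⟨z, hB z h⟩} with hS
  have hbdd : ∀ r ∈ S, 0 ≤ r := by
    rintro r ⟨z, h, rfl⟩
    exact (e ⟨z, hB z h⟩).2
  have hne : S.Nonempty := ⟨_, b, hb, rfl⟩
  have h0 : 0 ≤ sInf S := le_csInf hne hbdd
  refine ⟨e.symm ⟨sInf S, h0⟩, (e.symm ⟨sInf S, h0⟩).2, fun z hz => ?_, fun w hw => ?_⟩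
  · have : e.symm ⟨sInf S, h0⟩ ≤ ⟨z, hB z hz⟩ := by
      rw [e.symm_apply_le]
      exact csInf_le ⟨0, hbdd⟩ ⟨z, hz, rfl⟩
    exact this
  · have hwa : a ≤ w := (e.symm ⟨sInf S, h0⟩).2.trans hw.le
    have : e.symm ⟨sInf S, h0⟩ < ⟨w, hwa⟩ := hw
    rw [e.symm_apply_lt] at this
    obtain ⟨r, ⟨z, hz, rfl⟩, hr⟩ := exists_lt_of_csInf_lt hne this
    exact ⟨z, hz, e.lt_iff_lt.1 (Subtype.coe_lt_coe.1 hr)⟩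

theorem exists_upper_bound (hT : IsDirectedTree T) (x y : T) : ∃ z, x ≤ z ∧ y ≤ z := by
  obtain ⟨w, hw⟩ := hT.directed x y
  exact ⟨w, hw.1 (by simp), hw.1 (by simp)⟩

end IsDirectedTree

/-! ### Horizontal subgroups -/

section Horizontal

variable {G T : Type*} [Group G] [PartialOrder T]

/-- A subgroup is horizontal if its orbits are antichains. -/
def IsHorizontal (Φ : G →* (T ≃o T)) (M : Subgroup G) : Prop :=
  ∀ m ∈ M, ∀ x, Φ m x ≤ x → Φ m x = x

/-- The preorder induced on `T` by the order of the quotient by a subgroup. -/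
def OrbitLE (Φ : G →* (T ≃o T)) (M : Subgroup G) (x y : T) : Prop :=
  ∃ m ∈ M, Φ m x ≤ y

variable {Φ : G →* (T ≃o T)} {M : Subgroup G}

theorem action_mul (Φ : G →* (T ≃o T)) (g h : G) (x : T) : Φ (g * h) x = Φ g (Φ h x) := by
  rw [map_mul]; rfl

@[simp] theorem action_one (Φ : G →* (T ≃o T)) (x : T) : Φ 1 x = x := by
  rw [map_one]; rfl

@[simp] theorem action_inv_apply (Φ : G →* (T ≃o T)) (g : G) (x : T) : Φ g⁻¹ (Φ g x) = x := by
  rw [← action_mul]; simp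

@[simp] theorem action_apply_inv (Φ : G →* (T ≃o T)) (g : G) (x : T) : Φ g (Φ g⁻¹ x) = x := by
  rw [← action_mul]; simp

theorem isHorizontal_bot (Φ : G →* (T ≃o T)) : IsHorizontal Φ ⊥ := by
  intro m hm x _
  rw [Subgroup.mem_bot.1 hm, action_one]

theorem orbitLE_bot {x y : T} : OrbitLE Φ ⊥ x y ↔ x ≤ y := by
  simp [OrbitLE]

theorem OrbitLE.of_le {x y : T} (h : x ≤ y) : OrbitLE Φ M x y :=
  ⟨1, one_mem _, by simpa using h⟩

theorem orbitLE_apply_self {m : G} (hm : m ∈ M) (x : T) : OrbitLE Φ M (Φ m x) x :=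
  ⟨m⁻¹, inv_mem hm, by simp⟩

theorem orbitLE_self_apply {m : G} (hm : m ∈ M) (x : T) : OrbitLE Φ M x (Φ m x) :=
  ⟨m, hm, le_rfl⟩

theorem OrbitLE.trans {x y z : T} (h : OrbitLE Φ M x y) (h' : OrbitLE Φ M y z) :
    OrbitLE Φ M x z := by
  obtain ⟨m, hm, h⟩ := h
  obtain ⟨m', hm', h'⟩ := h'
  refine ⟨m' * m, mul_mem hm' hm, ?_⟩
  rw [action_mul]
  exact ((Φ m').monotone h).trans h'

theorem OrbitLE.map [hM : M.Normal] (g : G) {x y : T} (h : OrbitLE Φ M x y) :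
    OrbitLE Φ M (Φ g x) (Φ g y) := by
  obtain ⟨m, hm, h⟩ := h
  refine ⟨g * m * g⁻¹, hM.conj_mem m hm g, ?_⟩
  rw [action_mul, action_mul, action_inv_apply]
  exact (Φ g).monotone h

theorem orbitLE_inv_iff [M.Normal] (g : G) {x y : T} :
    OrbitLE Φ M (Φ g⁻¹ x) y ↔ OrbitLE Φ M x (Φ g y) :=
  ⟨fun h => by simpa using h.map g, fun h => by simpa using h.map g⁻¹⟩

theorem OrbitLE.total_of_le (hT : IsDirectedTree T) {a x y : T} (hx : OrbitLE Φ M a x)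
    (hy : OrbitLE Φ M a y) : OrbitLE Φ M x y ∨ OrbitLE Φ M y x := by
  obtain ⟨m, hm, hx⟩ := hx
  obtain ⟨n, hn, hy⟩ := hy
  have hx' : Φ n a ≤ Φ (n * m⁻¹) x := by
    rw [action_mul]
    exact (Φ n).monotone (by rw [← (Φ m).le_iff_le]; simpa using hx)
  rcases hT.le_total_of_le hx' hy with h | h
  · exact Or.inl ⟨_, mul_mem hn (inv_mem hm), h⟩
  · exact Or.inr ((OrbitLE.of_le h).trans (orbitLE_apply_self (mul_mem hn (inv_mem hm)) x))

theorem IsHorizontal.apply_eq (hM : IsHorizontal Φ M) {m : G} (hm : m ∈ M) {x : T}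
    (h : x ≤ Φ m x) : Φ m x = x := by
  have := hM _ (inv_mem hm) (Φ m x) (by simpa using h)
  simpa using this.symm

theorem IsHorizontal.not_orbitLE_of_lt (hM : IsHorizontal Φ M) {x y : T} (h : x < y) :
    ¬ OrbitLE Φ M y x := by
  rintro ⟨m, hm, h'⟩
  exact (h'.trans_lt h).ne (hM m hm y (h'.trans h.le))

/-- An element of a horizontal subgroup fixes pointwise every ray it maps into a comparable one. -/
theorem IsHorizontal.apply_eq_of_le (hT : IsDirectedTree T) (hM : IsHorizontal Φ M) {m : G}
    (hm : m ∈ M) {x y : T} (h : x ≤ y) (h' : Φ m x ≤ y) : Φ m y = y := by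
  rcases hT.le_total_of_le ((Φ m).monotone h) h' with h1 | h1
  · exact hM m hm y h1
  · exact hM.apply_eq hm h1

/-! ### Ping-pong -/

/-- Going up from `a`, let `c` be the infimum of the points lying above `b` modulo `M`. By
d-minimality, a conjugate of `g` pushes a point just below `c` past `c`. -/
theorem exists_conj_crossing (hT : IsDirectedTree T) (hleaf : ∀ v : T, ¬ IsMin v)
    (hΦ : IsDMinimal Φ) {g : G} {x : T} (hx : x < Φ g x) {a b : T} (hab : ¬ OrbitLE Φ M b a) :
    ∃ k : G, ∃ a', a ≤ a' ∧ ¬ OrbitLE Φ M b a' ∧ a' ≤ Φ (k⁻¹ * g * k) a' ∧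
      OrbitLE Φ M b (Φ (k⁻¹ * g * k) a') := by
  obtain ⟨z, haz, hbz⟩ := hT.exists_upper_bound a b
  obtain ⟨c, hac, hc, hc'⟩ := hT.exists_isGLB (B := {z | a ≤ z ∧ OrbitLE Φ M b z})
    (fun z hz => hz.1) ⟨haz, OrbitLE.of_le hbz⟩
  have key : ∀ c₀ < c, ∃ k : G, ∃ c' ∈ Set.Ico c₀ c, c < Φ (k⁻¹ * g * k) c' := by
    intro c₀ h₀
    obtain ⟨k, c', hc', hk⟩ := hΦ x (Φ g x) c₀ c hx h₀
    refine ⟨k, c', hc', ?_⟩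
    have h1 := (hk ⟨c', ⟨le_rfl, hc'.2.le⟩, rfl⟩).1
    have h2 := (hk ⟨c, ⟨hc'.2.le, le_rfl⟩, rfl⟩).2
    rw [mul_assoc, action_mul, action_mul, ← (Φ k).lt_iff_lt, action_apply_inv]
    exact h2.trans ((Φ g).strictMono h1)
  -- If the infimum is attained, `a'` is taken just below `c`; otherwise `a' = c` itself works.
  by_cases hbc : OrbitLE Φ M b c
  · have hlt : a < c := lt_of_le_of_ne hac (by rintro rfl; exact hab hbc)
    obtain ⟨k, c', ⟨hac', hc'c⟩, h⟩ := key a hlt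
    exact ⟨k, c', hac', fun hb => absurd (hc c' ⟨hac', hb⟩) hc'c.not_ge, hc'c.le.trans h.le,
      hbc.trans (OrbitLE.of_le h.le)⟩
  · obtain ⟨c₀, h₀⟩ := not_isMin_iff.1 (hleaf c)
    obtain ⟨k, c', ⟨-, hc'c⟩, h⟩ := key c₀ h₀
    have h3 : c < Φ (k⁻¹ * g * k) c := h.trans ((Φ _).strictMono hc'c)
    obtain ⟨z, hz, hzc⟩ := hc' _ h3
    exact ⟨k, c, hac, hbc, h3.le, hz.2.trans (OrbitLE.of_le hzc.le)⟩

/-- Ping-pong on the set of points below `a'` or `b'` modulo `M`: `α⁻¹` sends it below `a'` and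
`β⁻¹` sends it below `b'`. The two Malcev words begin with different letters, so a law would give
`a'` and `b'` a common lower bound, making them comparable. -/
theorem IsHorizontal.of_satisfiesMalcevMod (hT : IsDirectedTree T) (hleaf : ∀ v : T, ¬ IsMin v)
    (hΦ : IsDMinimal Φ) [M.Normal] {a b : T} (hab : ¬ OrbitLE Φ M a b) (hba : ¬ OrbitLE Φ M b a)
    {K : Subgroup G} [hK : K.Normal] (hKM : SatisfiesMalcevMod K M) : IsHorizontal Φ K := by
  intro g₀ hg₀ x hx
  by_contra hne
  obtain ⟨g, hg, hgx⟩ : ∃ g ∈ K, x < Φ g x :=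
    ⟨g₀⁻¹, inv_mem hg₀, by rw [← (Φ g₀).lt_iff_lt, action_apply_inv]; exact lt_of_le_of_ne hx hne⟩
  obtain ⟨k, a', ha, hba', ha', hba''⟩ := exists_conj_crossing hT hleaf hΦ hgx hba
  obtain ⟨l, b', hb, hab', hb', hab''⟩ := exists_conj_crossing hT hleaf hΦ hgx hab
  set α := k⁻¹ * g * k
  set β := l⁻¹ * g * l
  have hα : α ∈ K := by simpa [α] using hK.conj_mem g hg k⁻¹
  have hβ : β ∈ K := by simpa [β] using hK.conj_mem g hg l⁻¹
  have n1 : ¬ OrbitLE Φ M a' b' := fun h => hab' ((OrbitLE.of_le ha).trans h)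
  have n2 : ¬ OrbitLE Φ M b' a' := fun h => hba' ((OrbitLE.of_le hb).trans h)
  have hA : OrbitLE Φ M b' (Φ α a') := by
    rcases (OrbitLE.of_le hb).total_of_le hT hba'' with h | h
    · exact h
    · exact absurd ((OrbitLE.of_le ha').trans h) n1
  have hB : OrbitLE Φ M a' (Φ β b') := by
    rcases (OrbitLE.of_le ha).total_of_le hT hab'' with h | h
    · exact h
    · exact absurd ((OrbitLE.of_le hb').trans h) n2
  have pα : ∀ z, OrbitLE Φ M z a' ∨ OrbitLE Φ M z b' → OrbitLE Φ M (Φ α⁻¹ z) a' := by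
    intro z hz
    rw [orbitLE_inv_iff]
    exact hz.elim (fun h => h.trans (OrbitLE.of_le ha')) (fun h => h.trans hA)
  have pβ : ∀ z, OrbitLE Φ M z a' ∨ OrbitLE Φ M z b' → OrbitLE Φ M (Φ β⁻¹ z) b' := by
    intro z hz
    rw [orbitLE_inv_iff]
    exact hz.elim (fun h => h.trans hB) (fun h => h.trans (OrbitLE.of_le hb'))
  have pn : ∀ n z, OrbitLE Φ M z a' ∨ OrbitLE Φ M z b' →
      OrbitLE Φ M (Φ (malcevWords α⁻¹ β⁻¹ n).1 z) a' ∧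
      OrbitLE Φ M (Φ (malcevWords α⁻¹ β⁻¹ n).2 z) b' := by
    intro n
    induction n with
    | zero => exact fun z hz => ⟨pα z hz, pβ z hz⟩
    | succ n ih =>
      intro z hz
      simp only [malcevWords, action_mul]
      exact ⟨(ih _ (Or.inr (ih z hz).2)).1, (ih _ (Or.inl (ih z hz).1)).2⟩
  obtain ⟨n, z, hz, h⟩ := hKM α⁻¹ (inv_mem hα) β⁻¹ (inv_mem hβ)
  -- Starting from `z⁻¹ a'` absorbs the error `z`, so both words yield the same point.
  have h1 := (pn n (Φ z⁻¹ a') (Or.inl (orbitLE_apply_self (inv_mem hz) a'))).1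
  have h2 := (pn n a' (Or.inl (OrbitLE.of_le le_rfl))).2
  rw [h, action_mul, action_apply_inv] at h1
  rcases OrbitLE.total_of_le (a := Φ (malcevWords α⁻¹ β⁻¹ n).2 a') hT h1 h2 with h | h
  · exact n1 h
  · exact n2 h

/-- Horizontal subgroups have infinite index. -/
theorem IsHorizontal.not_finiteIndex [Nonempty T] (hleaf : ∀ v : T, ¬ IsMin v)
    (hΦ : IsDMinimal Φ) (hM : IsHorizontal Φ M) : ¬ M.FiniteIndex := by
  intro hfin
  obtain ⟨w⟩ := ‹Nonempty T›
  obtain ⟨w₀, hw₀⟩ := not_isMin_iff.1 (hleaf w)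
  -- Iterating gives translates of `w` strictly increasing towards `w`; the elements producing them
  -- lie in distinct cosets of `M`.
  have step : ∀ v : {v // v < w}, ∃ g : G, v.1 < Φ g w ∧ Φ g w < w := by
    rintro ⟨v, hv⟩
    obtain ⟨g, w', hw', hg⟩ := hΦ v w w₀ w hv hw₀
    exact ⟨g, hg ⟨w, ⟨hw'.2.le, le_rfl⟩, rfl⟩⟩
  choose γ h1 h2 using step
  let s : ℕ → {v // v < w} := fun n => Nat.rec ⟨w₀, hw₀⟩ (fun _ v => ⟨Φ (γ v) w, h2 v⟩) n
  have hs : ∀ n, (s (n + 1)).1 = Φ (γ (s n)) w := fun n => rfl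
  have hmono : StrictMono fun n => Φ (γ (s n)) w := by
    refine strictMono_nat_of_lt_succ fun n => ?_
    have := h1 (s (n + 1))
    rwa [hs] at this
  have hinj : Function.Injective fun n => (γ (s n) : G ⧸ M) := by
    intro m n hmn
    by_contra hne
    wlog hlt : m < n generalizing m n
    · exact this hmn.symm (Ne.symm hne) (lt_of_le_of_ne (not_lt.1 hlt) (Ne.symm hne))
    have hmem := QuotientGroup.eq.1 hmn
    have h3 : w < Φ ((γ (s m))⁻¹ * γ (s n)) w := by
      rw [action_mul, ← (Φ (γ (s m))).lt_iff_lt, action_apply_inv]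
      exact hmono hlt
    exact h3.ne' (hM.apply_eq hmem h3.le)
  have : Finite (G ⧸ M) := inferInstance
  exact not_injective_infinite_finite _ hinj

end Horizontal

/-! ### Parametrizing lines in directed trees -/

section Line

variable {T : Type*} [PartialOrder T]

theorem IsDirectedTree.exists_param (hT : IsDirectedTree T) (a : T) :
    ∃ f : T → ℝ, StrictMonoOn f (Set.Ici a) ∧ f '' Set.Ici a = Set.Ici 0 ∧ f a = 0 := by
  classical
  obtain ⟨e⟩ := hT.ray a
  have hf : ∀ x (h : a ≤ x), (if h : a ≤ x then (e ⟨x, h⟩ : ℝ) else 0) = e ⟨x, h⟩ :=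
    fun x h => dif_pos h
  refine ⟨fun x => if h : a ≤ x then e ⟨x, h⟩ else 0, ?_, ?_, ?_⟩
  · intro x hx y hy hxy
    simp only [hf x hx, hf y hy]
    exact e.strictMono (Subtype.mk_lt_mk.2 hxy)
  · ext r
    constructor
    · rintro ⟨x, hx, rfl⟩
      simp only [hf x hx]
      exact (e ⟨x, hx⟩).2
    · intro hr
      refine ⟨e.symm ⟨r, hr⟩, (e.symm ⟨r, hr⟩).2, ?_⟩
      exact (hf _ (e.symm ⟨r, hr⟩).2).trans (congrArg Subtype.val (e.apply_symm_apply ⟨r, hr⟩))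
  · simp only [hf a le_rfl]
    refine le_antisymm ?_ (e ⟨a, le_rfl⟩).2
    have h : (⟨a, le_rfl⟩ : Set.Ici a) ≤ e.symm ⟨0, Set.self_mem_Ici⟩ :=
      (e.symm ⟨0, Set.self_mem_Ici⟩).2
    rw [e.le_symm_apply] at h
    exact h

/-- The added arc from `b` to `a` is rescaled to length one, so that infinitely many extensions
exhaust the real line. -/
theorem IsDirectedTree.exists_extend (hT : IsDirectedTree T) {a b : T} (hba : b < a) {f : T → ℝ}
    {r : ℝ} (hf : StrictMonoOn f (Set.Ici a)) (hfr : f '' Set.Ici a = Set.Ici r) :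
    ∃ F : T → ℝ, StrictMonoOn F (Set.Ici b) ∧ F '' Set.Ici b = Set.Ici (r - 1) ∧
      Set.EqOn F f (Set.Ici a) := by
  classical
  obtain ⟨h, hh, him, hb0⟩ := hT.exists_param b
  have ha : 0 < h a := hb0 ▸ hh le_rfl hba.le hba
  have hr : ∀ x, a ≤ x → r ≤ f x := fun x hx => hfr.subset ⟨x, hx, rfl⟩
  have hpos : ∀ x, a ≤ x → (if a ≤ x then f x else r - 1 + h x / h a) = f x :=
    fun x hx => if_pos hx
  have hneg : ∀ x, ¬ a ≤ x → (if a ≤ x then f x else r - 1 + h x / h a) = r - 1 + h x / h a :=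
    fun x hx => if_neg hx
  have hlt : ∀ x, b ≤ x → ¬ a ≤ x → x < a := fun x hx hax =>
    lt_of_le_not_ge ((hT.le_total_of_le hx hba.le).resolve_right hax) hax
  have hlt' : ∀ x, b ≤ x → ¬ a ≤ x → h x / h a < 1 := fun x hx hax =>
    (div_lt_one ha).2 (hh hx hba.le (hlt x hx hax))
  refine ⟨fun x => if a ≤ x then f x else r - 1 + h x / h a, ?_, ?_, fun x hx => hpos x hx⟩
  · intro x hx y hy hxy
    dsimp only
    by_cases hax : a ≤ x
    · rw [hpos x hax, hpos y (hax.trans hxy.le)]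
      exact hf hax (hax.trans hxy.le) hxy
    · rw [hneg x hax]
      by_cases hay : a ≤ y
      · rw [hpos y hay]
        linarith [hr y hay, hlt' x hx hax]
      · rw [hneg y hay]
        have := div_lt_div_of_pos_right (hh hx hy hxy) ha
        linarith
  · ext s
    constructor
    · rintro ⟨x, hx, rfl⟩
      dsimp only
      by_cases hax : a ≤ x
      · rw [hpos x hax, Set.mem_Ici]
        linarith [hr x hax]
      · rw [hneg x hax, Set.mem_Ici]
        have h0 : 0 ≤ h x := him.subset ⟨x, hx, rfl⟩
        linarith [div_nonneg h0 ha.le]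
    · intro hs
      by_cases hrs : r ≤ s
      · obtain ⟨x, hx, rfl⟩ := hfr.superset hrs
        exact ⟨x, hba.le.trans hx, hpos x hx⟩
      · have hs' : 0 ≤ (s - (r - 1)) * h a := mul_nonneg (sub_nonneg.2 hs) ha.le
        obtain ⟨x, hx, hxs⟩ := him.superset hs'
        have hax : ¬ a ≤ x := by
          intro hax
          have := hh.monotoneOn hba.le hx hax
          rw [hxs] at this
          nlinarith
        refine ⟨x, hx, ?_⟩
        dsimp only
        rw [hneg x hax, hxs, mul_div_cancel_right₀ _ ha.ne']
        ring

theorem IsDirectedTree.exists_line_param (hT : IsDirectedTree T) {t : ℕ → T} (ht : StrictAnti t) :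
    ∃ f : T → ℝ, StrictMonoOn f (⋃ n, Set.Ici (t n)) ∧ f '' (⋃ n, Set.Ici (t n)) = Set.univ := by
  let P : ℕ → (T → ℝ) → Prop := fun n f =>
    StrictMonoOn f (Set.Ici (t n)) ∧ f '' Set.Ici (t n) = Set.Ici (-n : ℝ)
  have step : ∀ n (f : {f // P n f}), ∃ F, P (n + 1) F ∧ Set.EqOn F f.1 (Set.Ici (t n)) := by
    rintro n ⟨f, hf⟩
    obtain ⟨F, h1, h2, h3⟩ := hT.exists_extend (ht n.lt_succ_self) hf.1 hf.2
    exact ⟨F, ⟨h1, by rw [h2]; push_cast; congr 1; ring⟩, h3⟩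
  choose E hE hE' using step
  obtain ⟨f₀, h0, h0', -⟩ := hT.exists_param (t 0)
  let φ : ∀ n, {f // P n f} := fun n =>
    Nat.rec ⟨f₀, h0, by simpa using h0'⟩ (fun n f => ⟨E n f, hE n f⟩) n
  have hφ : ∀ n, Set.EqOn (φ (n + 1)).1 (φ n).1 (Set.Ici (t n)) := fun n => hE' n (φ n)
  have hφ' : ∀ m n, m ≤ n → Set.EqOn (φ n).1 (φ m).1 (Set.Ici (t m)) := by
    intro m n hmn
    induction n, hmn using Nat.le_induction with
    | base => exact fun _ _ => rfl
    | succ n hmn ih =>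
      exact fun x hx => (hφ n ((ht.antitone hmn).trans hx)).trans (ih hx)
  classical
  let f : T → ℝ := fun x => if h : ∃ n, t n ≤ x then (φ (Nat.find h)).1 x else 0
  have hf : ∀ n x, t n ≤ x → f x = (φ n).1 x := by
    intro n x hx
    have h : ∃ n, t n ≤ x := ⟨n, hx⟩
    simp only [f, dif_pos h]
    exact (hφ' _ n (Nat.find_min' h hx) (Nat.find_spec h)).symm
  refine ⟨f, ?_, ?_⟩
  · intro x hx y hy hxy
    obtain ⟨n, hn⟩ := Set.mem_iUnion.1 hx
    have hn' : t n ≤ y := le_trans hn hxy.le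
    rw [hf n x hn, hf n y hn']
    exact (φ n).2.1 hn hn' hxy
  · refine Set.eq_univ_of_forall fun r => ?_
    obtain ⟨n, hn⟩ := exists_nat_ge (-r)
    obtain ⟨x, hx, rfl⟩ := (φ n).2.2.superset (show -(n : ℝ) ≤ r by linarith)
    exact ⟨x, Set.mem_iUnion.2 ⟨n, hx⟩, hf n x hx⟩

end Line

/-! ### The quotient by a horizontal subgroup with totally ordered orbit space -/

section Quotient

variable {G T : Type*} [Group G] [PartialOrder T] {Φ : G →* (T ≃o T)} {M : Subgroup G}

theorem exists_coinitial_strictAnti [Nonempty T] (hT : IsDirectedTree T)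
    (hleaf : ∀ v : T, ¬ IsMin v) (htot : ∀ x y, OrbitLE Φ M x y ∨ OrbitLE Φ M y x) :
    ∃ t : ℕ → T, StrictAnti t ∧ ∀ x, ∃ n, OrbitLE Φ M (t n) x := by
  obtain ⟨S, hS, hS'⟩ := hT.countable
  -- Without leaves, the countable set of (T3) is coinitial.
  have hco : ∀ x, ∃ s ∈ S, s ≤ x := by
    intro x
    obtain ⟨u, hu⟩ := not_isMin_iff.1 (hleaf x)
    obtain ⟨z, hz, -, h⟩ := hS' u x hu
    exact ⟨z, hz, h⟩
  have hne : S.Nonempty := by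
    obtain ⟨x⟩ := ‹Nonempty T›
    obtain ⟨s, hs, -⟩ := hco x
    exact ⟨s, hs⟩
  obtain ⟨s, rfl⟩ := hS.exists_eq_range hne
  have step : ∀ (n : ℕ) (v : T), ∃ u, u < v ∧ OrbitLE Φ M u (s n) := by
    intro n v
    rcases htot (s n) v with ⟨m, hm, h⟩ | h
    · obtain ⟨u, hu⟩ := not_isMin_iff.1 (hleaf (Φ m (s n)))
      exact ⟨u, hu.trans_le h, (OrbitLE.of_le hu.le).trans (orbitLE_apply_self hm _)⟩
    · obtain ⟨u, hu⟩ := not_isMin_iff.1 (hleaf v)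
      exact ⟨u, hu, (OrbitLE.of_le hu.le).trans h⟩
  choose d hd hd' using step
  let t : ℕ → T := fun n => Nat.rec (s 0) (fun n v => d n v) n
  refine ⟨t, strictAnti_nat_of_succ_lt fun n => hd n (t n), fun x => ?_⟩
  obtain ⟨_, ⟨n, rfl⟩, hn⟩ := hco x
  exact ⟨n + 1, (hd' n (t n)).trans (OrbitLE.of_le hn)⟩

/-- The union `L` of the rays from a descending sequence coinitial modulo `M` is a chain meeting
every orbit, and only once since `M` is horizontal. Parametrizing `L` by the reals parametrizes the
orbits. -/
theorem IsHorizontal.exists_quotient_map [Nonempty T] (hT : IsDirectedTree T)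
    (hleaf : ∀ v : T, ¬ IsMin v) (hM : IsHorizontal Φ M)
    (htot : ∀ x y, OrbitLE Φ M x y ∨ OrbitLE Φ M y x) :
    ∃ π : T → ℝ, Function.Surjective π ∧ ∀ x y, π x ≤ π y ↔ OrbitLE Φ M x y := by
  obtain ⟨t, ht, hco⟩ := exists_coinitial_strictAnti hT hleaf htot
  obtain ⟨f, hf, hfim⟩ := hT.exists_line_param ht
  set L := ⋃ n, Set.Ici (t n)
  have hρ : ∀ x, ∃ m ∈ M, Φ m x ∈ L := by
    intro x
    obtain ⟨n, m, hm, h⟩ := hco x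
    refine ⟨m⁻¹, inv_mem hm, Set.mem_iUnion.2 ⟨n, ?_⟩⟩
    rw [Set.mem_Ici, ← (Φ m).le_iff_le, action_apply_inv]
    exact h
  have hL : ∀ x ∈ L, ∀ y ∈ L, x ≤ y ∨ y ≤ x := by
    intro x hx y hy
    obtain ⟨m, hm⟩ := Set.mem_iUnion.1 hx
    obtain ⟨n, hn⟩ := Set.mem_iUnion.1 hy
    exact hT.le_total_of_le ((ht.antitone (le_max_left m n)).trans hm)
      ((ht.antitone (le_max_right m n)).trans hn)
  have hLM : ∀ x ∈ L, ∀ y ∈ L, OrbitLE Φ M x y → x ≤ y := by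
    intro x hx y hy h
    rcases hL x hx y hy with h' | h'
    · exact h'
    · exact (eq_of_le_of_not_lt h' fun hlt => hM.not_orbitLE_of_lt hlt h).ge
  choose μ hμ hμL using hρ
  refine ⟨fun x => f (Φ (μ x) x), fun r => ?_, fun x y => ?_⟩
  · obtain ⟨x, hx, rfl⟩ := hfim.superset (Set.mem_univ r)
    refine ⟨x, congrArg f (le_antisymm ?_ ?_)⟩
    · exact hLM _ (hμL x) _ hx (orbitLE_apply_self (hμ x) x)
    · exact hLM _ hx _ (hμL x) (orbitLE_self_apply (hμ x) x)
  · constructor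
    · intro h
      refine (orbitLE_self_apply (hμ x) x).trans (OrbitLE.trans ?_ (orbitLE_apply_self (hμ y) y))
      rcases hL _ (hμL x) _ (hμL y) with h' | h'
      · exact OrbitLE.of_le h'
      · exact OrbitLE.of_le (eq_of_le_of_not_lt h' fun hlt =>
          (hf (hμL y) (hμL x) hlt).not_ge h).ge
    · intro h
      refine hf.monotoneOn (hμL x) (hμL y) (hLM _ (hμL x) _ (hμL y) ?_)
      exact ((orbitLE_apply_self (hμ x) x).trans h).trans (orbitLE_self_apply (hμ y) y)

end Quotient

/-! ### The induced action on the line -/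

section InducedAction

variable {G T : Type*} [Group G] [PartialOrder T] {Φ : G →* (T ≃o T)} {M : Subgroup G}

theorem apply_congr_of_le_iff {π : T → ℝ} [M.Normal] (hle : ∀ x y, π x ≤ π y ↔ OrbitLE Φ M x y)
    (g : G) {x y : T} (h : π x = π y) : π (Φ g x) = π (Φ g y) :=
  le_antisymm ((hle _ _).2 (((hle _ _).1 h.le).map g)) ((hle _ _).2 (((hle _ _).1 h.ge).map g))

theorem exists_induced_action {π : T → ℝ} [M.Normal] (hπ : Function.Surjective π)
    (hle : ∀ x y, π x ≤ π y ↔ OrbitLE Φ M x y) :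
    ∃ j : G →* HomeoPlus, ∀ g v, π (Φ g v) = (j g : ℝ ≃ₜ ℝ) (π v) := by
  choose σ hσ using hπ
  let J : G → ℝ → ℝ := fun g r => π (Φ g (σ r))
  have hJ : ∀ g x, J g (π x) = π (Φ g x) := fun g x => apply_congr_of_le_iff hle g (hσ _)
  have hmul : ∀ g h r, J (g * h) r = J g (J h r) := by
    intro g h r
    obtain ⟨x, rfl⟩ : ∃ x, π x = r := ⟨_, hσ r⟩
    rw [hJ (g * h), hJ h, hJ g, action_mul]
  have hone : ∀ r, J 1 r = r := by
    intro r
    rw [← hσ r, hJ, action_one]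
  have hinv : ∀ g r, J g⁻¹ (J g r) = r := by
    intro g r
    rw [← hmul, inv_mul_cancel, hone]
  have hinv' : ∀ g r, J g (J g⁻¹ r) = r := by
    intro g r
    rw [← hmul, mul_inv_cancel, hone]
  have hmono : ∀ g, Monotone (J g) := by
    intro g r s hrs
    rw [← hσ r, ← hσ s] at hrs ⊢
    rw [hJ, hJ, hle]
    exact ((hle _ _).1 hrs).map g
  have hsurj : ∀ g, Function.Surjective (J g) := fun g r => ⟨_, hinv' g r⟩
  let j : G → HomeoPlus := fun g =>
    ⟨{ toFun := J g
       invFun := J g⁻¹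
       left_inv := hinv g
       right_inv := hinv' g
       continuous_toFun := (hmono g).continuous_of_surjective (hsurj g)
       continuous_invFun := (hmono g⁻¹).continuous_of_surjective (hsurj g⁻¹) },
      (hmono g).strictMono_of_injective (Function.LeftInverse.injective (hinv g))⟩
  refine ⟨MonoidHom.mk' j fun g h => Subtype.ext (Homeomorph.ext fun r => hmul g h r),
    fun g v => (hJ g v).symm⟩

theorem IsHorizontal.isHorograding {π : T → ℝ} (hT : IsDirectedTree T) (hM : IsHorizontal Φ M)
    (hπ : Function.Surjective π) (hle : ∀ x y, π x ≤ π y ↔ OrbitLE Φ M x y) :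
    IsHorograding π := by
  have hmono : StrictMono π := fun x y h =>
    lt_of_not_ge fun h' => hM.not_orbitLE_of_lt h ((hle _ _).1 h')
  refine ⟨hmono, fun u v huv => ⟨?_, ?_, ?_⟩⟩
  · exact fun z hz => ⟨hmono.monotone hz.1, hmono.monotone hz.2⟩
  · intro x hx y hy hxy
    rcases hT.le_total_of_le hx.1 hy.1 with h | h
    · exact eq_of_le_of_not_lt h fun hlt => (hmono hlt).ne hxy
    · exact (eq_of_le_of_not_lt h fun hlt => (hmono hlt).ne hxy.symm).symm
  · rintro r ⟨hur, hrv⟩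
    obtain ⟨z, rfl⟩ := hπ r
    obtain ⟨m, hm, h⟩ := (hle _ _).1 hur
    have hz : π (Φ m⁻¹ z) = π z :=
      le_antisymm ((hle _ _).2 (orbitLE_apply_self (inv_mem hm) z))
        ((hle _ _).2 (orbitLE_self_apply (inv_mem hm) z))
    have huz : u ≤ Φ m⁻¹ z := by
      rw [← (Φ m).le_iff_le, action_apply_inv]
      exact h
    refine ⟨Φ m⁻¹ z, ⟨huz, ?_⟩, hz⟩
    rcases hT.le_total_of_le huz huv.le with h' | h'
    · exact h'
    · exact (eq_of_le_of_not_lt h' fun hlt => (hmono hlt).not_ge (hz ▸ hrv)).ge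

theorem isMinimalLineAction_of_isDMinimal [Nonempty T] (hleaf : ∀ v : T, ¬ IsMin v)
    (hΦ : IsDMinimal Φ) {π : T → ℝ} (hmono : StrictMono π) (hπ : Function.Surjective π)
    (hle : ∀ x y, π x ≤ π y ↔ OrbitLE Φ M x y) {j : G →* HomeoPlus}
    (hj : ∀ g v, π (Φ g v) = (j g : ℝ ≃ₜ ℝ) (π v)) : IsMinimalLineAction j := by
  intro r
  refine dense_of_exists_between fun a b hab => ?_
  obtain ⟨w, rfl⟩ := hπ r
  obtain ⟨x, rfl⟩ := hπ a
  obtain ⟨y, rfl⟩ := hπ b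
  -- The lifts `x` and `y` may be incomparable, but an `M`-translate of `x`, with the same image,
  -- lies below `y`.
  obtain ⟨m, hm, h⟩ := (hle _ _).1 hab.le
  have hx : π (Φ m x) = π x :=
    le_antisymm ((hle _ _).2 (orbitLE_apply_self hm x)) ((hle _ _).2 (orbitLE_self_apply hm x))
  have hlt : Φ m x < y := lt_of_le_of_ne h fun h' => by rw [← hx, h'] at hab; exact hab.false
  obtain ⟨w₀, hw₀⟩ := not_isMin_iff.1 (hleaf w)
  obtain ⟨g, w', hw', hg⟩ := hΦ _ _ w₀ w hlt hw₀
  have hgw := hg ⟨w, ⟨hw'.2.le, le_rfl⟩, rfl⟩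
  refine ⟨_, ⟨g, rfl⟩, ?_, ?_⟩
  · change π x < (j g : ℝ ≃ₜ ℝ) (π w)
    rw [← hj, ← hx]
    exact hmono hgw.1
  · change (j g : ℝ ≃ₜ ℝ) (π w) < π y
    rw [← hj]
    exact hmono hgw.2

open scoped commutatorElement in
/-- In a minimal action on the line, a nilpotent normal subgroup all of whose elements fix a
neighbourhood of `+∞` acts trivially. -/
theorem le_ker_of_isNilpotent {j : G →* HomeoPlus} (hj : IsMinimalLineAction j) (N : Subgroup G)
    [hN : N.Normal] (hnil : Group.IsNilpotent N)
    (hgerm : ∀ n ∈ N, ∃ R : ℝ, ∀ r, R ≤ r → (j n : ℝ ≃ₜ ℝ) r = r) : N ≤ j.ker := by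
  have hact : ∀ g h r, (j (g * h) : ℝ ≃ₜ ℝ) r = (j g : ℝ ≃ₜ ℝ) ((j h : ℝ ≃ₜ ℝ) r) := by
    intro g h r
    rw [map_mul]; rfl
  have hker : ∀ g, g ∈ j.ker ↔ ∀ r, (j g : ℝ ≃ₜ ℝ) r = r := by
    intro g
    rw [MonoidHom.mem_ker]
    exact ⟨fun h r => by rw [h]; rfl, fun h => Subtype.ext (Homeomorph.ext h)⟩
  have hinv : ∀ g r, (j g : ℝ ≃ₜ ℝ) ((j g⁻¹ : ℝ ≃ₜ ℝ) r) = r := by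
    intro g r
    rw [← hact, mul_inv_cancel, map_one]; rfl
  have hmono : ∀ g, StrictMono (j g : ℝ ≃ₜ ℝ) := fun g => (j g).2
  have step : ∀ k, N.lowerCentralSeries (k + 1) ≤ j.ker → N.lowerCentralSeries k ≤ j.ker := by
    intro k hk f hf
    by_contra hfk
    -- Modulo the kernel, `f` is central in `N`, so its set of non-fixed points is `N`-invariant,
    -- and `N` fixes the supremum of that set.
    have hcomm : ∀ n ∈ N, ∀ r,
        (j f : ℝ ≃ₜ ℝ) ((j n : ℝ ≃ₜ ℝ) r) = (j n : ℝ ≃ₜ ℝ) ((j f : ℝ ≃ₜ ℝ) r) := by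
      intro n hn r
      have h1 := (hker _).1 (hk (Subgroup.commutator_mem_commutator hf hn))
        ((j (n * f) : ℝ ≃ₜ ℝ) r)
      rw [← hact] at h1
      have h2 : ⁅f, n⁆ * (n * f) = f * n := by
        rw [commutatorElement_def]
        group
      rw [h2] at h1
      rw [← hact, ← hact, h1]
    set S := {r : ℝ | (j f : ℝ ≃ₜ ℝ) r ≠ r}
    have hne : S.Nonempty := by
      by_contra h
      exact hfk ((hker f).2 fun r => by_contra fun hr => h ⟨r, hr⟩)
    have hbdd : BddAbove S := by
      obtain ⟨R, hR⟩ := hgerm f (N.lowerCentralSeries_le_self k hf)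
      exact ⟨R, fun r hr => le_of_not_ge fun h => hr (hR r h)⟩
    have hS : ∀ n ∈ N, ∀ r ∈ S, (j n : ℝ ≃ₜ ℝ) r ∈ S := by
      intro n hn r hr h
      rw [hcomm n hn] at h
      exact hr ((hmono n).injective h)
    have hle : ∀ n ∈ N, sSup S ≤ (j n : ℝ ≃ₜ ℝ) (sSup S) := by
      intro n hn
      refine csSup_le hne fun r hr => ?_
      have h := le_csSup hbdd (hS n⁻¹ (inv_mem hn) r hr)
      have := (hmono n).monotone h
      rwa [hinv] at this
    have hfix : ∀ n ∈ N, (j n : ℝ ≃ₜ ℝ) (sSup S) = sSup S := by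
      intro n hn
      refine le_antisymm ?_ (hle n hn)
      have := (hmono n).monotone (hle n⁻¹ (inv_mem hn))
      rwa [hinv] at this
    refine hfk ((hker f).2 fun r => ?_)
    refine congrFun (Continuous.ext_on (hj (sSup S)) (j f : ℝ ≃ₜ ℝ).continuous continuous_id ?_) r
    rintro _ ⟨g, rfl⟩
    -- By normality `g⁻¹ f g` also fixes `sSup S`, so `f` fixes its whole dense orbit.
    have hg := hfix _ (hN.conj_mem f (N.lowerCentralSeries_le_self k hf) g⁻¹)
    rw [inv_inv, hact, hact] at hg
    have := congrArg (j g : ℝ ≃ₜ ℝ) hg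
    rwa [hinv] at this
  obtain ⟨k, hk⟩ := (Subgroup.isNilpotent_iff_lowerCentralSeries N).1 hnil
  have hk' : N.lowerCentralSeries k ≤ j.ker := hk ▸ bot_le
  clear hk
  induction k with
  | zero => exact hk'
  | succ k ih => exact ih (step k hk')

/-- Nilpotent normal horizontal subgroups act trivially on the line. -/
theorem IsHorizontal.le_ker [Nonempty T] (hT : IsDirectedTree T) {π : T → ℝ}
    (hπ : Function.Surjective π) (hle : ∀ x y, π x ≤ π y ↔ OrbitLE Φ M x y) {j : G →* HomeoPlus}
    (hj : ∀ g v, π (Φ g v) = (j g : ℝ ≃ₜ ℝ) (π v)) (hmin : IsMinimalLineAction j)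
    {N : Subgroup G} [N.Normal] (hnil : Group.IsNilpotent N) (hN : IsHorizontal Φ N) :
    N ≤ j.ker := by
  refine le_ker_of_isNilpotent hmin N hnil fun n hn => ?_
  obtain ⟨x⟩ := ‹Nonempty T›
  obtain ⟨y, hxy, hny⟩ := hT.exists_upper_bound x (Φ n x)
  -- Every real from `π y` on is the image of a point above `y`, and `n` fixes all of those.
  refine ⟨π y, fun r hr => ?_⟩
  obtain ⟨z, rfl⟩ := hπ r
  obtain ⟨m, hm, h⟩ := (hle _ _).1 hr
  have hyz : y ≤ Φ m⁻¹ z := by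
    rw [← (Φ m).le_iff_le, action_apply_inv]
    exact h
  have hz : π (Φ m⁻¹ z) = π z :=
    le_antisymm ((hle _ _).2 (orbitLE_apply_self (inv_mem hm) z))
      ((hle _ _).2 (orbitLE_self_apply (inv_mem hm) z))
  rw [← hz, ← hj, hN.apply_eq_of_le hT hn (hxy.trans hyz) (hny.trans hyz)]

end InducedAction

/-! ### The main theorem -/

/-- The hypothesis `hleaf` says that the tree has no leaves, `hne` that it is not a line. -/
theorem mainTheorem8 {G : Type*} [Group G] (hG : IsVirtuallySolvable G)
    {T : Type*} [PartialOrder T] [Nonempty T] (hT : IsDirectedTree T)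
    (hleaf : ∀ v : T, ¬ IsMin v) (hne : ¬ Nonempty (T ≃o ℝ))
    (Φ : G →* (T ≃o T)) (hΦ : IsDMinimal Φ) :
    ∃ j : G →* HomeoPlus,
      IsMinimalLineAction j ∧ fittingSubgroup G ≤ j.ker ∧ IsHorogradedBy Φ j := by
  classical
  obtain ⟨H, hHn, hHf, n, hn⟩ := hG.exists_normal
  have hnorm := derivedChain_normal H
  have hex : ∃ n, IsHorizontal Φ (derivedChain H n) := ⟨n, hn ▸ isHorizontal_bot Φ⟩
  obtain ⟨M, hMn, hM, htot⟩ : ∃ M : Subgroup G, M.Normal ∧ IsHorizontal Φ M ∧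
      ∀ x y, OrbitLE Φ M x y ∨ OrbitLE Φ M y x := by
    obtain ⟨i, hi⟩ : ∃ i, Nat.find hex = i := ⟨_, rfl⟩
    cases i with
    | zero =>
      have := Nat.find_spec hex
      rw [hi] at this
      exact absurd hHf (this.not_finiteIndex hleaf hΦ)
    | succ i =>
      have hspec := Nat.find_spec hex
      rw [hi] at hspec
      refine ⟨_, hnorm (i + 1), hspec, fun x y => ?_⟩
      by_contra hxy
      rw [not_or] at hxy
      have := hnorm i
      have := hnorm (i + 1)
      exact Nat.find_min hex (m := i) (by omega) (IsHorizontal.of_satisfiesMalcevMod hT hleaf hΦ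
        hxy.1 hxy.2 (SatisfiesMalcevMod.commutator (derivedChain H i)))
  -- Were `T` totally ordered, its quotient by the trivial subgroup would identify it with the line.
  obtain ⟨a, b, hab, hba⟩ : ∃ a b : T, ¬ OrbitLE Φ ⊥ a b ∧ ¬ OrbitLE Φ ⊥ b a := by
    by_contra hall
    push Not at hall
    obtain ⟨f, hf, hf'⟩ := (isHorizontal_bot Φ).exists_quotient_map hT hleaf
      fun x y => or_iff_not_imp_left.2 (hall x y)
    simp only [orbitLE_bot] at hf'
    exact hne ⟨RelIso.ofSurjective (OrderEmbedding.ofMapLEIff f hf') hf⟩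
  obtain ⟨π, hπ, hle⟩ := hM.exists_quotient_map hT hleaf htot
  obtain ⟨j, hj⟩ := exists_induced_action hπ hle
  have hgr := hM.isHorograding hT hπ hle
  have hmin := isMinimalLineAction_of_isDMinimal hleaf hΦ hgr.strictMono hπ hle hj
  refine ⟨j, hmin, sSup_le ?_, π, hgr, hπ, hj⟩
  rintro N ⟨hNn, hnil⟩
  exact IsHorizontal.le_ker hT hπ hle hj hmin hnil (IsHorizontal.of_satisfiesMalcevMod hT hleaf hΦ
    hab hba (SatisfiesMalcevMod.of_isNilpotent N hnil))
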